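/- Let $K$ be an ordered field and let $K(i)=K+iK$, $i^2=-1$, with conjugation $\overline{x+iy}=x-iy$ for $x,y\in K$. Let $V$ be a vector space of finite dimension $n$ over $K(i)$ with basis $e_1,\dots,e_n$, and let $\varphi:V\times V\to K(i)$ be a non-negative definite hermitian form, that is, $\varphi$ is conjugate-linear in the first variable and linear in the second, $\overline{\varphi(v,w)}=\varphi(w,v)$ for all $v,w\in V$, and $\varphi(v,v)\ge 0$ for all $v\in V$. Write $\varphi_{jk}=\varphi(e_j,e_k)=a_{jk}+i\,b_{jk}$ with $a_{jk},b_{jk}\in K$. (Then $\varphi_{11},\dots,\varphi_{nn}$ and $\det(\varphi_{jk})$ lie in $K$.) The following hold. (i) $\varphi_{11}\cdots\varphi_{nn}\ \ge\ \det(a_{jk})\ \ge\ \det(\varphi_{jk})$ and $\varphi_{11}\cdots\varphi_{nn}\ \ge\ \det(a_{jk})\ \ge\ \det(b_{jk})$. (ii) $\varphi_{11}\cdots\varphi_{nn}=\det(a_{jk})=\det(\varphi_{jk})$ if and only if $\varphi_{kk}=0$ for some $k$, or $(\varphi_{jk})=(a_{jk})$ is diagonal. (iii) $\varphi_{11}\cdots\varphi_{nn}=\det(b_{jk})$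 if and only if $\varphi_{kk}=0$ for some $k$, or $(a_{jk})$ is diagonal and $\det(b_{jk})=\det(a_{jk})$. -/

import Mathlib

/-- The complexification `K(i) = K + iK` of `K`: pairs `re + im * i` with `i * i = -1`, and with
`star (x + y * i) = x - y * i`. -/
abbrev Complexification (K : Type*) [Field K] : Type _ := QuadraticAlgebra K (-1) 0

namespace Complexification

variable {K : Type*} [Field K] [LinearOrder K]

/-- In an ordered field `-1` is not a square, so that `K(i)` is a field. -/
theorem isField [IsStrictOrderedRing K] : IsField (Complexification K) :=
  haveI : Fact (∀ r : K, r ^ 2 ≠ -1 + 0 * r) := ⟨fun r h => by nlinarith [sq_nonneg r]⟩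
  Field.toIsField (QuadraticAlgebra K (-1) 0)

/-- The order of `K`, read in `K(i)`: `z ≤ w` means that `w - z` is an element of `K` and is
nonnegative there. On elements of `K` this is the order of `K`. -/
instance instPartialOrder : PartialOrder (Complexification K) where
  le z w := z.re ≤ w.re ∧ z.im = w.im
  le_refl z := ⟨le_refl _, rfl⟩
  le_trans _ _ _ h₁ h₂ := ⟨h₁.1.trans h₂.1, h₁.2.trans h₂.2⟩
  le_antisymm _ _ h₁ h₂ := QuadraticAlgebra.ext (le_antisymm h₁.1 h₂.1) h₁.2

theorem le_def (z w : Complexification K) : z ≤ w ↔ z.re ≤ w.re ∧ z.im = w.im := Iff.rfl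

theorem algebraMap_le_iff (x y : K) :
    algebraMap K (Complexification K) x ≤ algebraMap K (Complexification K) y ↔ x ≤ y := by
  simp [le_def]

end Complexification

/-- A hermitian form on a vector space `V` over `K(i)`: conjugate-linear in the first variable,
linear in the second, with `star (φ v w) = φ w v`. It is non-negative definite when, in addition,
`0 ≤ φ v v` for all `v`. -/
structure IsNonnegHermitian {K : Type*} [Field K] [LinearOrder K] [IsStrictOrderedRing K]
    {V : Type*} [AddCommGroup V] [Module (Complexification K) V]
    (φ : V →ₗ⋆[Complexification K] V →ₗ[Complexification K] Complexification K) : Prop where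
  conj_symm : ∀ v w : V, star (φ v w) = φ w v
  nonneg : ∀ v : V, 0 ≤ φ v v

/-- The matrix `φ_jk = φ(e_j, e_k)` of the form in a basis. -/
noncomputable def formMatrix {K : Type*} [Field K] {V : Type*} [AddCommGroup V] [Module (Complexification K) V]
    {n : ℕ} (e : Module.Basis (Fin n) (Complexification K) V)
    (φ : V →ₗ⋆[Complexification K] V →ₗ[Complexification K] Complexification K) :
    Matrix (Fin n) (Fin n) (Complexification K) :=
  Matrix.of fun j k => φ (e j) (e k)

/-- The entrywise real part `a_jk` of a matrix `φ_jk = a_jk + i b_jk`. -/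
def reMatrix {K : Type*} [Field K] {n : ℕ} (M : Matrix (Fin n) (Fin n) (Complexification K)) :
    Matrix (Fin n) (Fin n) K :=
  Matrix.of fun j k => (M j k).re

/-- The entrywise imaginary part `b_jk` of a matrix `φ_jk = a_jk + i b_jk`. -/
def imMatrix {K : Type*} [Field K] {n : ℕ} (M : Matrix (Fin n) (Fin n) (Complexification K)) :
    Matrix (Fin n) (Fin n) K :=
  Matrix.of fun j k => (M j k).im

/-!
Write `Φ = a + i b` for the Gram matrix. All the inequalities come from Hadamard's inequality
`0 ≤ det ≤ ∏ (diagonal)` for Gram matrices of non-negative hermitian forms, which is proved in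
`gram_det_hadamard` for any field with an involution and a compatible partial order; this covers
both `K` and `K(i)`. It is applied to three matrices.

* For `a` it is `det a ≤ ∏ a k k = ∏ Φ k k` (`det_hadamard`).
* For `det Φ ≤ det a`, there is a real invertible `Q` with `Q a Qᵀ` diagonal; the Gram matrix
  `Q Φ Qᵀ` has the same diagonal as `Q a Qᵀ`, so its determinant is at most `det (Q a Qᵀ)`, and
  `(det Q)²` cancels (`IsNonnegHermitian.det_le_det_reMatrix`).
* For `det b ≤ det a`, non-negativity of `Φ` says that `p ⬝ a p + q ⬝ a q + 2 p ⬝ b q ≥ 0` for all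
  real `p`, `q`. Again `a` may be taken to be a diagonal matrix `D`. If `D` is singular, `b` has a
  zero row. Otherwise the condition bounds the diagonal of `b D⁻¹ bᵀ` by that of `D`, so Hadamard's
  inequality gives `(det b)² ≤ (det D)²` (`det_le_prod_of_dominated`).

No square roots are needed, so that `K` can be any ordered field. If some `Φ k k` vanishes, then so
does the `k`-th row of `Φ`, and all the determinants are zero. Otherwise the equality cases are those
of Hadamard's inequality, for `Φ` in the first chain and for `a` in the second.
-/

/-! ### Gram determinants of non-negative hermitian forms -/

section Gram

variable {F : Type*} [CommRing F] {σ : F →+* F} {V : Type*} [AddCommGroup V] [Module F V]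

/-- The Gram matrix `φ (v j) (v k)` of a family of vectors `v` under a sesquilinear form `φ`. -/
def gramMatrix {ι : Type*} (φ : V →ₛₗ[σ] V →ₗ[F] F) (v : ι → V) : Matrix ι ι F :=
  Matrix.of fun j k => φ (v j) (v k)

@[simp]
theorem gramMatrix_apply {ι : Type*} (φ : V →ₛₗ[σ] V →ₗ[F] F) (v : ι → V) (j k : ι) :
    gramMatrix φ v j k = φ (v j) (v k) := rfl

theorem gramMatrix_sum_smul {ι κ : Type*} [Fintype κ] (φ : V →ₛₗ[σ] V →ₗ[F] F) (v : κ → V)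
    (C : Matrix ι κ F) :
    gramMatrix φ (fun j => ∑ k, C j k • v k) = C.map σ * gramMatrix φ v * C.transpose := by
  ext j k
  simp only [gramMatrix_apply, Matrix.mul_apply, Matrix.map_apply, Matrix.transpose_apply, map_sum,
    LinearMap.sum_apply, map_smulₛₗ, LinearMap.smul_apply, smul_eq_mul, Finset.sum_mul,
    RingHom.id_apply]
  refine Finset.sum_congr rfl fun l _ => ?_
  rw [Finset.mul_sum]
  refine Finset.sum_congr rfl fun m _ => ?_
  ring

variable [PartialOrder F] [IsStrictOrderedRing F]

/-- An isotropic vector of a non-negative form is in its radical. Otherwise `c = φ z w` is nonzero,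
and the value of the form at `w - s c z`, where `c' = σ c`, is `φ w w - 2 s c' c`; it is negative
for one of `s = φ w w / (c' c)` and `s = 1`. -/
theorem form_eq_zero_of_self_eq_zero (hF : IsField F) (hσ : ∀ x : F, 0 ≤ σ x * x)
    {φ : V →ₛₗ[σ] V →ₗ[F] F} (hφ : φ.IsSymm) (hpos : ∀ v, 0 ≤ φ v v) {z : V} (hz : φ z z = 0)
    (w : V) : φ z w = 0 := by
  have : IsDomain F := hF.isDomain
  have hσσ : σ (σ (φ z w)) = φ z w := by rw [hφ.eq, hφ.eq]
  by_contra hc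
  have hc' : σ (φ z w) ≠ 0 := fun h => hc (by rw [← hσσ, h, map_zero])
  have key : ∀ s : F, σ s = s → 0 ≤ φ w w - 2 * (s * (σ (φ z w) * φ z w)) := by
    intro s hs
    have h := hpos (w - (s * φ z w) • z)
    have e : φ (w - (s * φ z w) • z) (w - (s * φ z w) • z)
        = φ w w - 2 * (s * (σ (φ z w) * φ z w)) := by
      simp only [map_sub, LinearMap.sub_apply, map_smulₛₗ, LinearMap.smul_apply, smul_eq_mul,
        RingHom.id_apply, map_mul, hs, hz, ← hφ.eq z w]
      ring
    rwa [e] at h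
  obtain ⟨t, ht⟩ := hF.mul_inv_cancel (mul_ne_zero hc' hc)
  have hσt : σ t = t := by
    have h1 := congrArg σ ht
    rw [map_mul, map_mul, hσσ, map_one, mul_comm (φ z w)] at h1
    exact mul_left_cancel₀ (mul_ne_zero hc' hc) (h1.trans ht.symm)
  have h1 := key (φ w w * t) (by rw [map_mul, hσt, hφ.eq])
  have e1 : φ w w - 2 * (φ w w * t * (σ (φ z w) * φ z w)) = - φ w w := by
    linear_combination (-2 * φ w w) * ht
  rw [e1] at h1
  have hw : φ w w = 0 := le_antisymm (neg_nonneg.mp h1) (hpos w)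
  have h2 := key 1 (map_one σ)
  rw [hw, one_mul, zero_sub, neg_nonneg] at h2
  have h3 : 0 < σ (φ z w) * φ z w := lt_of_le_of_ne (hσ _) (mul_ne_zero hc' hc).symm
  exact absurd h2 (not_le_of_gt (mul_pos two_pos h3))

/-- Hadamard's inequality for Gram determinants, with the case of equality. The induction splits
off the first vector: if it is anisotropic, the others are replaced by their components orthogonal
to it, which leaves the determinant unchanged and does not increase their values under the form. -/
theorem gram_det_hadamard (hF : IsField F) (hσ : ∀ x : F, 0 ≤ σ x * x)
    {φ : V →ₛₗ[σ] V →ₗ[F] F} (hφ : φ.IsSymm) (hpos : ∀ v, 0 ≤ φ v v) {n : ℕ} (v : Fin n → V) :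
    0 ≤ (gramMatrix φ v).det ∧ (gramMatrix φ v).det ≤ ∏ k, φ (v k) (v k) ∧
      ((gramMatrix φ v).det = ∏ k, φ (v k) (v k) → (∀ k, φ (v k) (v k) ≠ 0) →
        ∀ j k, j ≠ k → φ (v j) (v k) = 0) := by
  have : IsDomain F := hF.isDomain
  induction n with
  | zero => simp
  | succ n ih =>
    by_cases h0 : φ (v 0) (v 0) = 0
    · have hdet : (gramMatrix φ v).det = 0 := Matrix.det_eq_zero_of_row_eq_zero 0 fun j =>
        form_eq_zero_of_self_eq_zero hF hσ hφ hpos h0 (v j)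
      rw [hdet]
      exact ⟨le_rfl, Finset.prod_nonneg fun k _ => hpos (v k), fun _ h => absurd h0 (h 0)⟩
    have hα : 0 < φ (v 0) (v 0) := lt_of_le_of_ne (hpos _) (Ne.symm h0)
    obtain ⟨β, hβ⟩ := hF.mul_inv_cancel h0
    have hσβ : σ β = β := by
      have h1 := congrArg σ hβ
      rw [map_mul, map_one, hφ.eq] at h1
      exact mul_left_cancel₀ h0 (h1.trans hβ.symm)
    have hβ0 : β ≠ 0 := fun h => by simp [h] at hβ
    have hβpos : 0 < β := by
      refine lt_of_le_of_ne ?_ hβ0.symm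
      have h1 := mul_nonneg (hσ β) (hpos (v 0))
      rwa [hσβ, mul_assoc, mul_comm β (φ _ _), hβ, mul_one] at h1
    set w : Fin n → V := fun k => v k.succ - (β * φ (v 0) (v k.succ)) • v 0 with hw
    have hww : ∀ j k, φ (w j) (w k)
        = φ (v j.succ) (v k.succ) - β * (φ (v j.succ) (v 0) * φ (v 0) (v k.succ)) := by
      intro j k
      simp only [hw, map_sub, LinearMap.sub_apply, map_smulₛₗ, LinearMap.smul_apply, smul_eq_mul,
        RingHom.id_apply, map_mul, hσβ, hφ.eq]
      linear_combination (φ (v j.succ) (v 0) * φ (v 0) (v k.succ) * β) * hβ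
    have hdet : (gramMatrix φ v).det = φ (v 0) (v 0) * (gramMatrix φ w).det := by
      rw [Matrix.det_eq_of_forall_row_eq_smul_add_const (A := gramMatrix φ v)
        (B := Matrix.of fun i j => φ (v i) (v j) -
          (Fin.cases 0 (fun i => β * φ (v i.succ) (v 0)) i : F) * φ (v 0) (v j))
        (fun i => Fin.cases 0 (fun i => β * φ (v i.succ) (v 0)) i) 0 rfl
        (fun i j => by simp)]
      rw [Matrix.det_succ_column_zero, Fin.sum_univ_succ]
      rw [Finset.sum_eq_zero, add_zero]
      · simp only [Fin.val_zero, pow_zero, one_mul, Matrix.of_apply, Fin.cases_zero, zero_mul,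
          sub_zero]
        congr 2
        ext j k
        simp only [Matrix.submatrix_apply, Fin.zero_succAbove, Matrix.of_apply, Fin.cases_succ,
          gramMatrix_apply, hww]
        ring
      · intro i _
        have : φ (v i.succ) (v 0) - β * φ (v i.succ) (v 0) * φ (v 0) (v 0) = 0 := by
          linear_combination (- φ (v i.succ) (v 0)) * hβ
        simp [this]
    obtain ⟨ih0, ih1, ih2⟩ := ih w
    have hle : ∀ k, φ (w k) (w k) ≤ φ (v k.succ) (v k.succ) := by
      intro k
      rw [hww, ← hφ.eq (v 0) (v k.succ)]
      exact sub_le_self _ (mul_nonneg hβpos.le (hσ _))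
    have hprod : ∏ k, φ (w k) (w k) ≤ ∏ k : Fin n, φ (v k.succ) (v k.succ) :=
      Finset.prod_le_prod (fun k _ => hpos _) fun k _ => hle k
    rw [hdet, Fin.prod_univ_succ]
    refine ⟨mul_nonneg hα.le ih0, mul_le_mul_of_nonneg_left (ih1.trans hprod) hα.le, ?_⟩
    intro heq hne
    have heq' := mul_left_cancel₀ h0 heq
    have hprod' : ∏ k, φ (w k) (w k) = ∏ k : Fin n, φ (v k.succ) (v k.succ) :=
      le_antisymm hprod (heq' ▸ ih1)
    have hwne : ∀ k, φ (w k) (w k) ≠ 0 := by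
      have h1 : ∏ k, φ (w k) (w k) ≠ 0 := by
        rw [hprod']
        exact Finset.prod_ne_zero_iff.mpr fun k _ => hne k.succ
      exact fun k => Finset.prod_ne_zero_iff.mp h1 k (Finset.mem_univ k)
    have hself : ∀ k, φ (w k) (w k) = φ (v k.succ) (v k.succ) := by
      intro k
      by_contra hk
      exact (Finset.prod_lt_prod (fun k _ => lt_of_le_of_ne (hpos (w k)) (hwne k).symm)
        (fun k _ => hle k) ⟨k, Finset.mem_univ k, lt_of_le_of_ne (hle k) hk⟩).ne hprod'
    have hcol : ∀ k : Fin n, φ (v k.succ) (v 0) = 0 := by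
      intro k
      have h1 := hself k
      rw [hww, sub_eq_self] at h1
      have h2 := (mul_eq_zero.mp h1).resolve_left hβ0
      rcases mul_eq_zero.mp h2 with h | h
      · exact h
      · rw [← hφ.eq (v 0), h, map_zero]
    have hrow : ∀ k : Fin n, φ (v 0) (v k.succ) = 0 := fun k => by
      rw [← hφ.eq (v k.succ), hcol, map_zero]
    have hoff := ih2 (heq'.trans hprod'.symm) hwne
    intro j k
    refine Fin.cases ?_ (fun j => ?_) j <;> refine Fin.cases ?_ (fun k => ?_) k
    · exact fun h => absurd rfl h
    · exact fun _ => hrow k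
    · exact fun _ => hcol j
    · intro h
      have h1 := hoff j k fun h' => h (congrArg Fin.succ h')
      rwa [hww, hcol, zero_mul, mul_zero, sub_zero] at h1

end Gram

/-! ### Real symmetric matrices and pairs of matrices dominated by them -/

section Real

open Matrix

variable {K : Type*} [Field K] {n : ℕ}

theorem gramMatrix_toLinearMap₂' (M C : Matrix (Fin n) (Fin n) K) :
    gramMatrix (Matrix.toLinearMap₂' K M) (fun j => C j) = C * M * Cᵀ := by
  have h := gramMatrix_sum_smul (Matrix.toLinearMap₂' K M) (fun k => Pi.single k (1 : K)) C
  have h1 : (fun j => ∑ k, C j k • (Pi.single k (1 : K) : Fin n → K)) = fun j => C j := by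
    funext j
    exact (pi_eq_sum_univ' (C j)).symm
  have h2 : gramMatrix (Matrix.toLinearMap₂' K M) (fun k => Pi.single k (1 : K)) = M := by
    ext j k
    rw [gramMatrix_apply]
    simp [Matrix.toLinearMap₂'_apply']
  rw [h1, h2] at h
  exact h

theorem isSymm_toLinearMap₂' {a : Matrix (Fin n) (Fin n) K} (ha : a.IsSymm) :
    LinearMap.IsSymm (Matrix.toLinearMap₂' K a) where
  eq x y := by
    rw [RingHom.id_apply, Matrix.toLinearMap₂'_apply', Matrix.toLinearMap₂'_apply',
      Matrix.dotProduct_mulVec, ← Matrix.mulVec_transpose, ha.eq, dotProduct_comm]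

variable [LinearOrder K] [IsStrictOrderedRing K]

/-- Hadamard's inequality for the congruent matrix `C a Cᵀ`, where `a` is symmetric and
non-negative. -/
theorem det_congr_hadamard {a : Matrix (Fin n) (Fin n) K} (ha : a.IsSymm)
    (hpos : ∀ p, 0 ≤ p ⬝ᵥ (a *ᵥ p)) (C : Matrix (Fin n) (Fin n) K) :
    (C * a * Cᵀ).det ≤ ∏ k, (C * a * Cᵀ) k k ∧
      ((C * a * Cᵀ).det = ∏ k, (C * a * Cᵀ) k k → (∀ k, (C * a * Cᵀ) k k ≠ 0) →
        (C * a * Cᵀ).IsDiag) := by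
  have h := gram_det_hadamard (Field.toIsField K) (σ := RingHom.id K)
    (fun x => mul_self_nonneg x) (isSymm_toLinearMap₂' ha)
    (fun p => by rw [Matrix.toLinearMap₂'_apply']; exact hpos p) (fun j => C j)
  have hentry : ∀ j k, Matrix.toLinearMap₂' K a (C j) (C k) = (C * a * Cᵀ) j k := fun j k => by
    rw [← gramMatrix_toLinearMap₂', gramMatrix_apply]
  simp only [gramMatrix_toLinearMap₂', hentry] at h
  exact ⟨h.2.1, fun h1 h2 j k hjk => h.2.2 h1 h2 j k hjk⟩

theorem det_hadamard {a : Matrix (Fin n) (Fin n) K} (ha : a.IsSymm)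
    (hpos : ∀ p, 0 ≤ p ⬝ᵥ (a *ᵥ p)) :
    a.det ≤ ∏ k, a k k ∧ (a.det = ∏ k, a k k → (∀ k, a k k ≠ 0) → a.IsDiag) := by
  simpa using det_congr_hadamard ha hpos 1

theorem exists_congr_isDiag {a : Matrix (Fin n) (Fin n) K} (ha : a.IsSymm) :
    ∃ Q : Matrix (Fin n) (Fin n) K, Q.det ≠ 0 ∧ (Q * a * Qᵀ).IsDiag := by
  have : Invertible (2 : K) := invertibleOfNonzero two_ne_zero
  obtain ⟨v, hv⟩ := LinearMap.BilinForm.exists_orthogonal_basis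
    (isSymm_toLinearMap₂' ha)
  let w := v.reindex (finCongr (Module.finrank_fin_fun K))
  refine ⟨Matrix.of fun j => w j, ?_, ?_⟩
  · have h : LinearIndependent K (Matrix.of fun j => w j).row := w.linearIndependent
    rw [Matrix.linearIndependent_rows_iff_isUnit, Matrix.isUnit_iff_isUnit_det] at h
    exact h.ne_zero
  · intro j k hjk
    rw [← gramMatrix_toLinearMap₂']
    have := LinearMap.isOrthoᵢ_def.mp hv
      ((finCongr (Module.finrank_fin_fun K)).symm j)
      ((finCongr (Module.finrank_fin_fun K)).symm k)
      fun h => hjk ((finCongr (Module.finrank_fin_fun K)).symm.injective h)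
    rw [gramMatrix_apply]
    simp only [w, Module.Basis.coe_reindex]
    exact this

/-- If the block matrix with diagonal blocks `D = diag d` and off-diagonal blocks `b`, `bᵀ` is
non-negative, then `det b ≤ det D`. When `D` is invertible, the diagonal entries of `b D⁻¹ bᵀ` are
at most those of `D`, and Hadamard's inequality for `b D⁻¹ bᵀ` gives `(det b)² ≤ (det D)²`. -/
theorem det_le_prod_of_dominated {d : Fin n → K} {b : Matrix (Fin n) (Fin n) K}
    (hpos : ∀ p q : Fin n → K,
      0 ≤ p ⬝ᵥ (diagonal d *ᵥ p) + q ⬝ᵥ (diagonal d *ᵥ q) + 2 * (p ⬝ᵥ (b *ᵥ q))) :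
    b.det ≤ ∏ k, d k := by
  have hd : ∀ k, 0 ≤ d k := fun k => by
    simpa using hpos (Pi.single k 1) 0
  by_cases h0 : ∃ k, d k = 0
  · obtain ⟨k, hk⟩ := h0
    have hrow : ∀ j, b k j = 0 := by
      intro j
      by_contra hj
      -- `2 * s * b k j = -(d j + 1)` for this multiple `s` of the `k`-th unit vector
      have h := hpos (Pi.single k (-(d j + 1) / (2 * b k j))) (Pi.single j 1)
      simp only [mulVec_single, single_dotProduct] at h
      simp [hk] at h
      have e : 2 * ((-1 + -d j) / (2 * b k j) * b k j) = -1 + -d j := by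
        field_simp
      rw [e] at h
      linarith
    rw [Matrix.det_eq_zero_of_row_eq_zero k hrow]
    exact Finset.prod_nonneg fun k _ => hd k
  · push Not at h0
    have hd' : ∀ k, 0 < d k := fun k => lt_of_le_of_ne (hd k) (h0 k).symm
    have hD : ∀ p : Fin n → K, 0 ≤ p ⬝ᵥ (diagonal (fun k => (d k)⁻¹) *ᵥ p) := fun p =>
      Finset.sum_nonneg fun k _ => by
        rw [mulVec_diagonal, mul_left_comm]
        exact mul_nonneg (inv_nonneg.mpr (hd k)) (mul_self_nonneg _)
    have hB := (det_congr_hadamard (isSymm_diagonal fun k => (d k)⁻¹) hD b).1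
    have hentry : ∀ k, (b * diagonal (fun k => (d k)⁻¹) * bᵀ) k k = ∑ j, b k j ^ 2 / d j := by
      intro k
      rw [Matrix.mul_apply]
      refine Finset.sum_congr rfl fun j _ => ?_
      rw [Matrix.mul_diagonal, Matrix.transpose_apply]
      ring
    have hle : ∀ k, (b * diagonal (fun k => (d k)⁻¹) * bᵀ) k k ≤ d k := by
      intro k
      -- `q = -D⁻¹ bᵀ p` minimizes the quadratic form for given `p`
      have h := hpos (Pi.single k 1) (fun j => -(b k j / d j))
      have e1 : (fun j => -(b k j / d j)) ⬝ᵥ (diagonal d *ᵥ fun j => -(b k j / d j))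
          = ∑ j, b k j ^ 2 / d j := by
        refine Finset.sum_congr rfl fun j _ => ?_
        rw [mulVec_diagonal]
        have := h0 j
        field_simp
      have e2 : (Pi.single k 1 : Fin n → K) ⬝ᵥ (b *ᵥ fun j => -(b k j / d j))
          = -∑ j, b k j ^ 2 / d j := by
        rw [single_one_dotProduct, ← Finset.sum_neg_distrib, mulVec, dotProduct]
        refine Finset.sum_congr rfl fun j _ => ?_
        ring
      have e3 : (Pi.single k 1 : Fin n → K) ⬝ᵥ (diagonal d *ᵥ Pi.single k 1) = d k := by
        simp
      rw [e1, e2, e3] at h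
      rw [hentry]
      linarith
    have hprod := hB.trans (Finset.prod_le_prod (fun k _ => by
      rw [hentry]
      exact Finset.sum_nonneg fun j _ => div_nonneg (sq_nonneg _) (hd j)) fun k _ => hle k)
    rw [det_mul, det_mul, det_diagonal, det_transpose, Finset.prod_inv_distrib] at hprod
    have hP : 0 < ∏ k, d k := Finset.prod_pos fun k _ => hd' k
    have hsq : b.det ^ 2 ≤ (∏ k, d k) ^ 2 := by
      have h1 := mul_le_mul_of_nonneg_right hprod hP.le
      have e : b.det * (∏ k, d k)⁻¹ * b.det * ∏ k, d k = b.det ^ 2 := by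
        field_simp
      rw [e] at h1
      rwa [sq (∏ k, d k)]
    exact (abs_le_of_sq_le_sq' hsq hP.le).2

/-- If `a` is symmetric and the block matrix with diagonal blocks `a` and off-diagonal blocks `b`,
`bᵀ` is non-negative, then `det b ≤ det a`. A congruence reduces this to diagonal `a`. -/
theorem det_le_det_of_dominated {a b : Matrix (Fin n) (Fin n) K} (ha : a.IsSymm)
    (hpos : ∀ p q : Fin n → K, 0 ≤ p ⬝ᵥ (a *ᵥ p) + q ⬝ᵥ (a *ᵥ q) + 2 * (p ⬝ᵥ (b *ᵥ q))) :
    b.det ≤ a.det := by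
  obtain ⟨Q, hQ, hdiag⟩ := exists_congr_isDiag ha
  have key : ∀ (M : Matrix (Fin n) (Fin n) K) (p q : Fin n → K),
      p ⬝ᵥ ((Q * M * Qᵀ) *ᵥ q) = (Qᵀ *ᵥ p) ⬝ᵥ (M *ᵥ (Qᵀ *ᵥ q)) := by
    intro M p q
    rw [← mulVec_mulVec, ← mulVec_mulVec, dotProduct_mulVec, ← mulVec_transpose]
  have h := det_le_prod_of_dominated (d := (Q * a * Qᵀ).diag) (b := Q * b * Qᵀ) (by
    intro p q
    rw [hdiag.diagonal_diag, key, key, key]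
    exact hpos _ _)
  rw [← det_diagonal, hdiag.diagonal_diag] at h
  simp only [det_mul, det_transpose] at h
  have hQ2 : 0 < Q.det * Q.det := mul_self_pos.mpr hQ
  refine le_of_mul_le_mul_left ?_ hQ2
  linarith

end Real

/-! ### Hermitian matrices over the complexification -/

namespace Complexification

open Matrix

variable {K : Type*} [Field K]

theorem re_sum {ι : Type*} (s : Finset ι) (f : ι → Complexification K) :
    (∑ i ∈ s, f i).re = ∑ i ∈ s, (f i).re :=
  map_sum (AddMonoidHom.mk' QuadraticAlgebra.re QuadraticAlgebra.re_add) f s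

theorem reMatrix_map_mul {n : ℕ} (Q R : Matrix (Fin n) (Fin n) K)
    (M : Matrix (Fin n) (Fin n) (Complexification K)) :
    reMatrix (Q.map (algebraMap K (Complexification K)) * M *
      R.map (algebraMap K (Complexification K))) = Q * reMatrix M * R := by
  ext j k
  simp [reMatrix, Matrix.mul_apply, re_sum]

variable [LinearOrder K] [IsStrictOrderedRing K]

instance instIsStrictOrderedRing : IsStrictOrderedRing (Complexification K) :=
  haveI : IsOrderedAddMonoid (Complexification K) :=
    { add_le_add_left := fun a b h c => by simpa [le_def] using h }
  haveI : ZeroLEOneClass (Complexification K) := ⟨zero_le_one (α := K), rfl⟩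
  .of_mul_pos fun a b ha hb => by
    have pos_iff : ∀ z : Complexification K, 0 < z ↔ 0 < z.re ∧ z.im = 0 := by
      intro z
      rw [lt_iff_le_not_ge, le_def, le_def]
      simp only [QuadraticAlgebra.re_zero, QuadraticAlgebra.im_zero]
      grind
    rw [pos_iff] at ha hb ⊢
    simp [ha.2, hb.2, mul_pos ha.1 hb.1]

theorem star_mul_self_nonneg (z : Complexification K) :
    0 ≤ starRingEnd (Complexification K) z * z := by
  rw [le_def, starRingEnd_apply]
  refine ⟨?_, ?_⟩
  · simp
    nlinarith [mul_self_nonneg z.re, mul_self_nonneg z.im]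
  · simp
    ring

end Complexification

namespace IsNonnegHermitian

open Matrix

variable {K : Type*} [Field K] [LinearOrder K] [IsStrictOrderedRing K]
  {V : Type*} [AddCommGroup V] [Module (Complexification K) V]
  {φ : V →ₗ⋆[Complexification K] V →ₗ[Complexification K] Complexification K}

theorem isSymm (hφ : IsNonnegHermitian φ) : φ.IsSymm := ⟨hφ.conj_symm⟩

theorem im_self (hφ : IsNonnegHermitian φ) (v : V) : (φ v v).im = 0 :=
  (hφ.nonneg v).2.symm

theorem eq_zero_of_self_eq_zero (hφ : IsNonnegHermitian φ) {z : V} (hz : φ z z = 0) (w : V) :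
    φ z w = 0 :=
  form_eq_zero_of_self_eq_zero Complexification.isField Complexification.star_mul_self_nonneg
    hφ.isSymm hφ.nonneg hz w

theorem hadamard (hφ : IsNonnegHermitian φ) {n : ℕ} (v : Fin n → V) :
    (gramMatrix φ v).det ≤ ∏ k, φ (v k) (v k) ∧
      ((gramMatrix φ v).det = ∏ k, φ (v k) (v k) → (∀ k, φ (v k) (v k) ≠ 0) →
        ∀ j k, j ≠ k → φ (v j) (v k) = 0) :=
  (gram_det_hadamard Complexification.isField Complexification.star_mul_self_nonneg
    hφ.isSymm hφ.nonneg v).2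

variable {n : ℕ} (v : Fin n → V)

theorem isSymm_reMatrix (hφ : IsNonnegHermitian φ) : (reMatrix (gramMatrix φ v)).IsSymm := by
  ext j k
  simp [reMatrix, ← hφ.conj_symm (v j) (v k)]

theorem transpose_imMatrix (hφ : IsNonnegHermitian φ) :
    (imMatrix (gramMatrix φ v))ᵀ = -imMatrix (gramMatrix φ v) := by
  ext j k
  simp [imMatrix, ← hφ.conj_symm (v j) (v k)]

/-- The expression is the value of the form at `∑ j, (p j - i q j) v j`, in terms of
the real and imaginary parts of the Gram matrix of `v`. -/
theorem re_im_nonneg (hφ : IsNonnegHermitian φ) (p q : Fin n → K) :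
    0 ≤ p ⬝ᵥ (reMatrix (gramMatrix φ v) *ᵥ p) + q ⬝ᵥ (reMatrix (gramMatrix φ v) *ᵥ q) +
      2 * (p ⬝ᵥ (imMatrix (gramMatrix φ v) *ᵥ q)) := by
  have hskew : q ⬝ᵥ (imMatrix (gramMatrix φ v) *ᵥ p)
      = -(p ⬝ᵥ (imMatrix (gramMatrix φ v) *ᵥ q)) := by
    rw [← dotProduct_neg, ← neg_mulVec, ← hφ.transpose_imMatrix v, mulVec_transpose,
      dotProduct_comm p, ← dotProduct_mulVec]
  have h := (hφ.nonneg (∑ j, (⟨p j, -q j⟩ : Complexification K) • v j)).1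
  have e : (φ (∑ j, (⟨p j, -q j⟩ : Complexification K) • v j)
      (∑ j, (⟨p j, -q j⟩ : Complexification K) • v j)).re
      = p ⬝ᵥ (reMatrix (gramMatrix φ v) *ᵥ p) + q ⬝ᵥ (reMatrix (gramMatrix φ v) *ᵥ q) +
      p ⬝ᵥ (imMatrix (gramMatrix φ v) *ᵥ q) - q ⬝ᵥ (imMatrix (gramMatrix φ v) *ᵥ p) := by
    simp only [map_sum, LinearMap.sum_apply, map_smulₛₗ, LinearMap.smul_apply, smul_eq_mul,
      RingHom.id_apply, Complexification.re_sum, dotProduct, mulVec, Finset.mul_sum,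
      ← Finset.sum_add_distrib, ← Finset.sum_sub_distrib]
    rw [Finset.sum_comm]
    refine Finset.sum_congr rfl fun j _ => Finset.sum_congr rfl fun k _ => ?_
    simp [reMatrix, imMatrix, starRingEnd_apply]
    ring
  rw [e, hskew] at h
  rw [QuadraticAlgebra.re_zero] at h
  linarith

/-- A real congruence makes the real part diagonal, and then this is Hadamard's
inequality for the congruent Gram matrix, whose diagonal is that of the congruent real part. -/
theorem det_le_det_reMatrix (hφ : IsNonnegHermitian φ) :
    (gramMatrix φ v).det ≤
      algebraMap K (Complexification K) (reMatrix (gramMatrix φ v)).det := by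
  obtain ⟨Q, hQ, hdiag⟩ := exists_congr_isDiag (hφ.isSymm_reMatrix v)
  have hG := gramMatrix_sum_smul φ v (Q.map (algebraMap K (Complexification K)))
  have hconj : (Q.map (algebraMap K (Complexification K))).map
      (starRingEnd (Complexification K)) = Q.map (algebraMap K (Complexification K)) := by
    ext j k <;> simp [starRingEnd_apply]
  rw [hconj, ← transpose_map] at hG
  have hdet : (Q.map (algebraMap K (Complexification K))).det
      = algebraMap K (Complexification K) Q.det :=
    (RingHom.map_det _ _).symm
  have h := (hφ.hadamard
    fun j => ∑ k, Q.map (algebraMap K (Complexification K)) j k • v k).1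
  set w : Fin n → V := fun j => ∑ k, Q.map (algebraMap K (Complexification K)) j k • v k
  have hself : ∀ k, φ (w k) (w k) = algebraMap K (Complexification K)
      ((Q * reMatrix (gramMatrix φ v) * Qᵀ).diag k) := by
    intro k
    refine QuadraticAlgebra.ext ?_ ?_
    · rw [← Complexification.reMatrix_map_mul, ← hG]
      simp [reMatrix]
    · rw [hφ.im_self]
      simp
  rw [Finset.prod_congr rfl fun k _ => hself k, ← map_prod, ← det_diagonal,
    hdiag.diagonal_diag, hG, det_mul, det_mul, det_mul, det_mul, transpose_map,
    det_transpose, det_transpose, hdet] at h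
  have h1 := h.1
  have h2 := h.2
  have hQ2 : 0 < Q.det * Q.det := mul_self_pos.mpr hQ
  refine ⟨?_, ?_⟩
  · refine le_of_mul_le_mul_left ?_ hQ2
    simp at h1 ⊢
    linarith
  · simp at h2 ⊢
    tauto

end IsNonnegHermitian

/-! ### Comparison of the determinants -/

theorem theorem4p2 {K : Type*} [Field K] [LinearOrder K] [IsStrictOrderedRing K]
    {V : Type*} [AddCommGroup V] [Module (Complexification K) V] {n : ℕ}
    (e : Module.Basis (Fin n) (Complexification K) V)
    (φ : V →ₗ⋆[Complexification K] V →ₗ[Complexification K] Complexification K)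
    (hφ : IsNonnegHermitian φ)
    (Φ : Matrix (Fin n) (Fin n) (Complexification K)) (hΦ : Φ = formMatrix e φ)
    (a b : Matrix (Fin n) (Fin n) K) (ha : a = reMatrix Φ) (hb : b = imMatrix Φ) :
    -- (i) the two chains of inequalities
    ((algebraMap K (Complexification K) a.det ≤ ∏ k, Φ k k ∧
        Φ.det ≤ algebraMap K (Complexification K) a.det) ∧
      (algebraMap K (Complexification K) a.det ≤ ∏ k, Φ k k ∧ b.det ≤ a.det)) ∧
    -- (ii) equality throughout the first chain
    ((∏ k, Φ k k = algebraMap K (Complexification K) a.det ∧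
        algebraMap K (Complexification K) a.det = Φ.det) ↔
      (∃ k, Φ k k = 0) ∨ (Φ = a.map (algebraMap K (Complexification K)) ∧ a.IsDiag)) ∧
    -- (iii) equality of the two ends of the second chain
    (∏ k, Φ k k = algebraMap K (Complexification K) b.det ↔
      (∃ k, Φ k k = 0) ∨ (a.IsDiag ∧ b.det = a.det)) := by
  have hG : Φ = gramMatrix φ e := hΦ
  have hpos := hφ.re_im_nonneg e
  have hsymm := hφ.isSymm_reMatrix e
  have hΦa := hφ.det_le_det_reMatrix e
  rw [← hG, ← ha] at hsymm hΦa
  rw [← hG, ← ha, ← hb] at hpos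
  have hinj : Function.Injective (algebraMap K (Complexification K)) :=
    QuadraticAlgebra.algebraMap_injective
  have hdiag : ∀ k, Φ k k = algebraMap K (Complexification K) (a k k) := by
    intro k
    refine QuadraticAlgebra.ext (by simp [ha, reMatrix]) ?_
    rw [hG, gramMatrix_apply, hφ.im_self]
    simp
  have hprod : ∏ k, Φ k k = algebraMap K (Complexification K) (∏ k, a k k) := by
    rw [map_prod]
    exact Finset.prod_congr rfl fun k _ => hdiag k
  have hba : b.det ≤ a.det := det_le_det_of_dominated hsymm hpos
  obtain ⟨hHad, hHadEq⟩ := det_hadamard hsymm fun p => by simpa using hpos p 0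
  have haΦ : algebraMap K (Complexification K) a.det ≤ ∏ k, Φ k k := by
    rwa [hprod, Complexification.algebraMap_le_iff]
  have hne : (¬∃ k, Φ k k = 0) → ∀ k, a k k ≠ 0 := fun h k hk =>
    h ⟨k, by rw [hdiag, hk, map_zero]⟩
  have hdiagprod : a.IsDiag → a.det = ∏ k, a k k := fun h => by
    conv_lhs => rw [← h.diagonal_diag, Matrix.det_diagonal]
    rfl
  -- an isotropic basis vector gives a zero row in each of the three matrices
  have hzero : ∀ k, Φ k k = 0 →
      ∏ k, Φ k k = 0 ∧ Φ.det = 0 ∧ a.det = 0 ∧ b.det = 0 := by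
    intro k hk
    have hrow : ∀ j, Φ k j = 0 := fun j => by
      rw [hG] at hk ⊢
      exact hφ.eq_zero_of_self_eq_zero hk (e j)
    refine ⟨Finset.prod_eq_zero (Finset.mem_univ k) hk, Matrix.det_eq_zero_of_row_eq_zero k hrow,
      Matrix.det_eq_zero_of_row_eq_zero k fun j => ?_,
      Matrix.det_eq_zero_of_row_eq_zero k fun j => ?_⟩
    · simp [ha, reMatrix, hrow]
    · simp [hb, imMatrix, hrow]
  refine ⟨⟨⟨haΦ, hΦa⟩, haΦ, hba⟩, ⟨?_, ?_⟩, ?_, ?_⟩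
  · rintro ⟨h1, h2⟩
    by_cases h0 : ∃ k, Φ k k = 0
    · exact Or.inl h0
    right
    have hoff : ∀ j k, j ≠ k → Φ j k = 0 := by
      have h := (hφ.hadamard e).2
      rw [← hG] at h
      rw [hG]
      refine h ?_ fun k hk => h0 ⟨k, by rw [hG]; exact hk⟩
      rw [← h2, ← h1, hG]
      rfl
    refine ⟨?_, fun j k hjk => ?_⟩
    · ext1 j k
      by_cases hjk : j = k
      · rw [hjk, hdiag, Matrix.map_apply]
      · rw [Matrix.map_apply, ha]
        simp [reMatrix, hoff j k hjk]
    · simp [ha, reMatrix, hoff j k hjk]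
  · rintro (⟨k, hk⟩ | ⟨h1, h2⟩)
    · obtain ⟨e1, e2, e3, -⟩ := hzero k hk
      rw [e1, e2, e3, map_zero]
      exact ⟨rfl, rfl⟩
    · refine ⟨by rw [hprod, hdiagprod h2], ?_⟩
      rw [h1]
      exact RingHom.map_det _ _
  · intro h
    by_cases h0 : ∃ k, Φ k k = 0
    · exact Or.inl h0
    right
    rw [hprod] at h
    have h1 := hinj h
    have h2 : a.det = ∏ k, a k k := le_antisymm hHad (h1 ▸ hba)
    exact ⟨hHadEq h2 (hne h0), by rw [← h1, h2]⟩
  · rintro (⟨k, hk⟩ | ⟨h1, h2⟩)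
    · obtain ⟨e1, -, -, e4⟩ := hzero k hk
      rw [e1, e4, map_zero]
    · rw [hprod, h2, hdiagprod h1]
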